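/- A skew left brace is a triple $(A,+,\circ)$ in which $(A,+)$ and $(A,\circ)$ are (not necessarily abelian) groups on the same set with $a\circ(b+c)=a\circ b-a+a\circ c$ for all $a,b,c\in A$; it is of abelian type if $(A,+)$ is abelian. Its socle is the ideal $\operatorname{Soc}(A)=\{x\in A : x\circ a=x+a \text{ and } x+a=a+x \text{ for all } a\in A\}$, so that the quotient $A/\operatorname{Soc}(A)$ is again a skew left brace. $A$ has finite multipermutation level if the sequence $S_1=A$, $S_{n+1}=S_n/\operatorname{Soc}(S_n)$ $(n\ge 1)$ reaches the zero (one-element) skew left brace. **Theorem.** Let $A$ be a skew left brace whose multiplicative group $(A,\circ)$ is isomorphic to $\mathbb{Z}$. Then $A$ has finite multipermutation level if and only if $A$ is of abelian type. -/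

import Mathlib

universe u

/-- A skew left brace `(A, +, ∘)`: two (not necessarily abelian) group structures on `A` with
`a ∘ (b + c) = a ∘ b - a + a ∘ c`. The circle operation `∘` is written `*`, so the multiplicative
group `(A, ∘)` is the `Group` structure and the additive group is the `AddGroup` structure. -/
class SkewLeftBrace (A : Type u) extends AddGroup A, Group A where
  circ_add : ∀ a b c : A, a * (b + c) = a * b - a + a * c

namespace SkewLeftBrace

section Basic

variable {A : Type u} [SkewLeftBrace A]

/-- The map `λ_a(b) = -a + a ∘ b`. -/
def lam (a b : A) : A := -a + a * b

theorem circ_eq (a b : A) : a * b = a + lam a b := by simp [lam]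

theorem circ_zero (a : A) : a * 0 = a := by
  have h := circ_add a 0 0
  rw [add_zero, sub_eq_add_neg, add_assoc] at h
  have h2 := left_eq_add.mp h
  exact (neg_add_eq_zero.mp h2).symm

theorem zero_eq_one : (0 : A) = 1 := by
  have h := circ_zero (1 : A)
  rwa [one_mul] at h

theorem lam_add (a b c : A) : lam a (b + c) = lam a b + lam a c := by
  simp only [lam, circ_add, sub_eq_add_neg, add_assoc]

theorem lam_one (b : A) : lam 1 b = b := by
  simp [lam, ← zero_eq_one (A := A)]

theorem lam_zero (a : A) : lam a 0 = 0 := by simp [lam, circ_zero]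

theorem lam_neg (a b : A) : lam a (-b) = -lam a b := by
  rw [eq_neg_iff_add_eq_zero, ← lam_add, neg_add_cancel, lam_zero]

theorem lam_circ (a b c : A) : lam (a * b) c = lam a (lam b c) := by
  have h : a * b + lam (a * b) c = a * b + lam a (lam b c) := by
    rw [← circ_eq, mul_assoc, circ_eq b c, circ_eq a (b + lam b c), lam_add, ← add_assoc,
      ← circ_eq]
  exact add_left_cancel h

theorem lam_lam_inv (a b : A) : lam a (lam a⁻¹ b) = b := by
  rw [← lam_circ, mul_inv_cancel, lam_one]

theorem lam_inv_lam (a b : A) : lam a⁻¹ (lam a b) = b := by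
  rw [← lam_circ, inv_mul_cancel, lam_one]

theorem lam_self_inv (a : A) : lam a a⁻¹ = -a := by
  simp [lam, ← zero_eq_one (A := A)]

theorem lam_inv_circ (a b : A) : lam a (a⁻¹ * b) = -a + b := by simp [lam]

end Basic

/-- An ideal of a skew left brace: a subgroup `I` of the additive group with `λ_a(I) ⊆ I` that is
normal in the additive group (`a + I = I + a`) and in the multiplicative group
(`a ∘ I = I ∘ a`). -/
structure Ideal (A : Type u) [SkewLeftBrace A] extends AddSubgroup A where
  lam_mem : ∀ (a : A) {x : A}, x ∈ carrier → lam a x ∈ carrier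
  add_conj_mem : ∀ (a : A) {x : A}, x ∈ carrier → a + x - a ∈ carrier
  circ_conj_mem : ∀ (a : A) {x : A}, x ∈ carrier → a * x * a⁻¹ ∈ carrier

namespace Ideal

variable {A : Type u} [SkewLeftBrace A] (I : Ideal A)

instance normal : I.toAddSubgroup.Normal :=
  ⟨fun x hx a => by rw [← sub_eq_add_neg]; exact I.add_conj_mem a hx⟩

/-- An ideal is also a subgroup of the multiplicative group. -/
def toSubgroup : Subgroup A where
  carrier := I.carrier
  one_mem' := by rw [← zero_eq_one]; exact I.zero_mem'
  mul_mem' := fun {x y} hx hy => by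
    rw [circ_eq]; exact I.add_mem' hx (I.lam_mem x hy)
  inv_mem' := fun {x} hx => by
    have h := I.lam_mem x⁻¹ (I.neg_mem' hx)
    rwa [← lam_self_inv, lam_inv_lam] at h

instance normal_toSubgroup : I.toSubgroup.Normal := ⟨fun _ hx a => I.circ_conj_mem a hx⟩

/-- Additive and multiplicative cosets of an ideal coincide. -/
theorem neg_add_mem_iff (a b : A) : -a + b ∈ I.toAddSubgroup ↔ a⁻¹ * b ∈ I.toSubgroup := by
  constructor
  · intro h
    have h2 := I.lam_mem a⁻¹ h
    rwa [← lam_inv_circ, lam_inv_lam] at h2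
  · intro h
    rw [← lam_inv_circ]
    exact I.lam_mem a h

/-- The underlying set of the quotient skew left brace `A / I`: the set of (additive) cosets. -/
def Factor : Type u := A ⧸ I.toAddSubgroup

/-- The projection `A → A / I`. -/
def proj (a : A) : I.Factor := QuotientAddGroup.mk a

theorem proj_eq_iff (a b : A) : I.proj a = I.proj b ↔ -a + b ∈ I.toAddSubgroup :=
  QuotientAddGroup.eq

theorem proj_eq_iff_circ (a b : A) : I.proj a = I.proj b ↔ a⁻¹ * b ∈ I.toSubgroup :=
  (I.proj_eq_iff a b).trans (I.neg_add_mem_iff a b)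

theorem proj_eq_iff_mk (a b : A) :
    I.proj a = I.proj b ↔ (QuotientGroup.mk a : A ⧸ I.toSubgroup) = QuotientGroup.mk b :=
  (I.proj_eq_iff_circ a b).trans QuotientGroup.eq.symm

theorem proj_surjective : Function.Surjective I.proj := QuotientAddGroup.mk_surjective

theorem proj_circ_congr (a b c d : A) (h₁ : I.proj a = I.proj b) (h₂ : I.proj c = I.proj d) :
    I.proj (a * c) = I.proj (b * d) := by
  rw [proj_eq_iff_mk] at *
  rw [QuotientGroup.mk_mul, QuotientGroup.mk_mul, h₁, h₂]

theorem proj_inv_congr (a b : A) (h : I.proj a = I.proj b) : I.proj a⁻¹ = I.proj b⁻¹ := by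
  rw [proj_eq_iff_mk] at *
  rw [QuotientGroup.mk_inv, QuotientGroup.mk_inv, h]

instance : AddGroup I.Factor := inferInstanceAs (AddGroup (A ⧸ I.toAddSubgroup))

instance : Mul I.Factor :=
  ⟨Quotient.map₂ (fun a b => a * b) (fun a b h₁ c d h₂ =>
    Quotient.exact (I.proj_circ_congr a b c d (Quotient.sound h₁) (Quotient.sound h₂)))⟩

instance : Inv I.Factor :=
  ⟨Quotient.map (fun a => a⁻¹) (fun a b h =>
    Quotient.exact (I.proj_inv_congr a b (Quotient.sound h)))⟩

instance : One I.Factor := ⟨I.proj 1⟩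

theorem proj_add (a b : A) : I.proj (a + b) = I.proj a + I.proj b := rfl

theorem proj_sub (a b : A) : I.proj (a - b) = I.proj a - I.proj b := rfl

theorem proj_circ (a b : A) : I.proj (a * b) = I.proj a * I.proj b := rfl

theorem proj_inv (a : A) : I.proj a⁻¹ = (I.proj a)⁻¹ := rfl

theorem proj_one : I.proj 1 = 1 := rfl

instance : Group I.Factor :=
  Group.ofLeftAxioms
    (fun x y z => by
      obtain ⟨a, rfl⟩ := I.proj_surjective x
      obtain ⟨b, rfl⟩ := I.proj_surjective y
      obtain ⟨c, rfl⟩ := I.proj_surjective z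
      simp only [← proj_circ, mul_assoc])
    (fun x => by
      obtain ⟨a, rfl⟩ := I.proj_surjective x
      rw [← proj_one, ← proj_circ, one_mul])
    (fun x => by
      obtain ⟨a, rfl⟩ := I.proj_surjective x
      rw [← proj_inv, ← proj_circ, inv_mul_cancel, proj_one])

/-- The quotient skew left brace `A / I`: both operations are induced from `A`. -/
instance : SkewLeftBrace I.Factor where
  circ_add x y z := by
    obtain ⟨a, rfl⟩ := I.proj_surjective x
    obtain ⟨b, rfl⟩ := I.proj_surjective y
    obtain ⟨c, rfl⟩ := I.proj_surjective z
    have h := congrArg I.proj (circ_add a b c)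
    exact h

end Ideal

section Socle

variable {A : Type u} [SkewLeftBrace A]

/-- `x ∘ a = x + a` and `x + a = a + x` for all `a`. -/
def InSocle (x : A) : Prop := ∀ a : A, x * a = x + a ∧ x + a = a + x

theorem InSocle.lam_eq {x : A} (hx : InSocle x) (a : A) : lam x a = a := by
  rw [lam, (hx a).1, neg_add_cancel_left]

theorem inSocle_of {x : A} (h₁ : ∀ a, lam x a = a) (h₂ : ∀ a, x + a = a + x) : InSocle x :=
  fun a => ⟨by rw [circ_eq, h₁], h₂ a⟩

theorem InSocle.lam_central {x : A} (hx : InSocle x) (a b : A) :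
    lam a x + b = b + lam a x := by
  have h := congrArg (lam a) (hx (lam a⁻¹ b)).2
  rwa [lam_add, lam_add, lam_lam_inv] at h

theorem InSocle.circ_conj_eq {x : A} (hx : InSocle x) (a : A) : a * x * a⁻¹ = lam a x := by
  rw [mul_assoc, (hx a⁻¹).1, circ_eq, lam_add, lam_self_inv, ← add_assoc,
    ← hx.lam_central a a, add_neg_cancel_right]

theorem InSocle.lam {x : A} (hx : InSocle x) (a : A) : InSocle (lam a x) := by
  refine inSocle_of (fun b => ?_) (hx.lam_central a)
  rw [← hx.circ_conj_eq a, lam_circ, lam_circ, hx.lam_eq, lam_lam_inv]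

variable (A) in
/-- The socle `Soc(A) = {x | x ∘ a = x + a and x + a = a + x for all a}`, as an ideal of `A`. -/
def socle : Ideal A where
  carrier := {x | ∀ a : A, x * a = x + a ∧ x + a = a + x}
  zero_mem' := fun a => by
    refine ⟨?_, by simp⟩
    rw [zero_add, zero_eq_one, one_mul]
  add_mem' := fun {x y} hx hy a => by
    have h : x + y = x * y := ((hx y).1).symm
    constructor
    · rw [h, mul_assoc, (hy a).1, (hx _).1, ← add_assoc, h]
    · rw [add_assoc, (hy a).2, ← add_assoc, (hx a).2, add_assoc]
  neg_mem' := fun {x} hx => by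
    change InSocle x at hx
    have h : -x = x⁻¹ := by rw [← lam_self_inv, hx.lam_eq]
    refine inSocle_of (fun a => ?_) (fun a => ?_)
    · have h2 := lam_inv_lam x a
      rwa [hx.lam_eq, ← h] at h2
    · rw [neg_add_eq_iff_eq_add, ← add_assoc, (hx a).2, add_neg_cancel_right]
  lam_mem := fun a {x} hx => InSocle.lam (x := x) hx a
  add_conj_mem := fun a {x} hx => by
    rw [← (hx a).2, add_sub_cancel_right]; exact hx
  circ_conj_mem := fun a {x} hx => by
    rw [InSocle.circ_conj_eq (x := x) hx a]; exact InSocle.lam (x := x) hx a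

end Socle

/-- A skew left brace bundled with its underlying type. -/
structure Bundled : Type (u + 1) where
  carrier : Type u
  [str : SkewLeftBrace carrier]

attribute [instance] Bundled.str

/-- `S ↦ S / Soc(S)`. -/
def Bundled.modSocle (S : Bundled.{u}) : Bundled.{u} := ⟨(socle S.carrier).Factor⟩

/-- The sequence `S_1 = A`, `S_{n+1} = S_n / Soc(S_n)`, indexed from `0`
(`socleSeq A n` is `S_{n+1}`). -/
def socleSeq (A : Type u) [SkewLeftBrace A] (n : ℕ) : Bundled.{u} := Bundled.modSocle^[n] ⟨A⟩

/-- `A` has finite multipermutation level if some `S_n` is zero, i.e. has only one element. -/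
def HasFiniteMultipermutationLevel (A : Type u) [SkewLeftBrace A] : Prop :=
  ∃ n : ℕ, Subsingleton (socleSeq A n).carrier

/-- `A` is of abelian type if its additive group is abelian. -/
def IsOfAbelianType (A : Type u) [SkewLeftBrace A] : Prop := ∀ a b : A, a + b = b + a

end SkewLeftBrace

/-! Finite level implies abelian: the socle is nonzero, and a nonzero ideal has finite index because
`(A, ∘)` is ℤ. The socle is additively central, so by Schur the additive commutator subgroup is
finite; being stable under all `lam a`, it is a finite subgroup of ℤ, hence zero.

Abelian implies finite level: π : ℤ → A is a bijective cocycle whose generator acts by some u.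
Surjectivity gives, for each p commuting with u, an n with u^n = 1 + (u - 1)p
(`exists_sub_one_mul`). Taking p = 1 + u² makes A finitely generated, then free. Taking p = a ∈ ℤ
makes every 1 + a(u - 1) invertible, so det(u - 1) = 0 and u fixes some y ≠ 0. If π m = 2 π 1, the
action on y forces m = 2, whence u = 1 (`eq_one`): `lam` is trivial and the socle is everything. -/

open Polynomial
open scoped commutatorElement

/-! ### Auxiliary results on groups and lattices -/

/-- Schur's theorem: a group whose center contains a subgroup of finite index has a finite
commutator subgroup. -/
theorem finite_commutator_of_le_center {G : Type*} [Group G] (H : Subgroup G) [Finite (G ⧸ H)]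
    (hH : H ≤ Subgroup.center G) : Finite (commutator G) := by
  have hcomm : ∀ a b : G, ⁅(a : G ⧸ H).out, (b : G ⧸ H).out⁆ = ⁅a, b⁆ := by
    intro a b
    obtain ⟨⟨c, hcH⟩, hc⟩ := QuotientGroup.mk_out_eq_mul H a
    obtain ⟨⟨d, hdH⟩, hd⟩ := QuotientGroup.mk_out_eq_mul H b
    have hc' := Subgroup.mem_center_iff.mp (hH hcH)
    have hd' := Subgroup.mem_center_iff.mp (hH hdH)
    simp only [hc, hd, commutatorElement_def]
    calc a * c * (b * d) * (a * c)⁻¹ * (b * d)⁻¹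
        = a * (c * (b * d * c⁻¹)) * a⁻¹ * d⁻¹ * b⁻¹ := by group
      _ = a * (b * d * c⁻¹ * c) * a⁻¹ * d⁻¹ * b⁻¹ := by rw [← hc']
      _ = a * b * (d * a⁻¹) * d⁻¹ * b⁻¹ := by group
      _ = a * b * (a⁻¹ * d) * d⁻¹ * b⁻¹ := by rw [← hd']
      _ = a * b * a⁻¹ * b⁻¹ := by group
  have : Finite (commutatorSet G) := by
    refine Set.Finite.subset
      (Set.finite_range fun q : (G ⧸ H) × (G ⧸ H) => ⁅q.1.out, q.2.out⁆) ?_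
    rintro _ ⟨a, b, rfl⟩
    exact ⟨(a, b), hcomm a b⟩
  -- A group with finitely many commutators has finite commutator subgroup.
  infer_instance

/-- If `1 + a N` has determinant `±1` for every integer `a`, then `N` is singular. -/
theorem Matrix.det_eq_zero_of_forall_sq_det_smul_add_one {ι : Type*} [Fintype ι] [DecidableEq ι]
    [Nonempty ι] (N : Matrix ι ι ℤ) (h : ∀ a : ℤ, (a • N + 1).det ^ 2 = 1) : N.det = 0 := by
  -- det(XN + 1) squares to 1 at every integer, so it is constant; its coefficient in degree |ι| is
  -- det N.
  set P : ℤ[X] := ((X : ℤ[X]) • N.map C + (1 : Matrix ι ι ℤ).map C).det with hP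
  have heval : ∀ a : ℤ, P.eval a = (a • N + 1).det := by
    intro a
    rw [hP, ← Polynomial.coe_evalRingHom, RingHom.map_det]
    congr 1
    ext i j
    by_cases hij : i = j <;> simp [-zsmul_eq_mul, hij]
  have hsq : P ^ 2 = 1 := by
    refine Polynomial.funext fun a => ?_
    rw [Polynomial.eval_pow, heval, h, Polynomial.eval_one]
  have hdeg : P.natDegree = 0 := by
    have := congrArg Polynomial.natDegree hsq
    rw [Polynomial.natDegree_pow, Polynomial.natDegree_one] at this
    omega
  rw [← Polynomial.coeff_det_X_add_C_card N 1, ← hP]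
  exact Polynomial.coeff_eq_zero_of_natDegree_lt (hdeg ▸ Fintype.card_pos)

/-- If `u` and all maps `1 + a (u - 1)` are invertible integral maps of a nonzero lattice, then `u`
fixes a nonzero vector. -/
theorem Module.End.exists_fixed_of_forall_isUnit {M : Type*} [AddCommGroup M] [Module.Finite ℤ M]
    [Module.Free ℤ M] [Nontrivial M] (u : Module.End ℤ M)
    (h : ∀ a : ℤ, IsUnit (1 + a • (u - 1))) : ∃ y ≠ 0, u y = y := by
  classical
  let b := Module.Free.chooseBasis ℤ M
  have hdet : LinearMap.det (u - 1) = 0 := by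
    rw [← LinearMap.det_toMatrix b]
    refine Matrix.det_eq_zero_of_forall_sq_det_smul_add_one _ fun a => ?_
    have h1 : a • LinearMap.toMatrix b b (u - 1) + 1 = LinearMap.toMatrix b b (1 + a • (u - 1)) := by
      rw [map_add, map_smul, LinearMap.toMatrix_one, add_comm]
    rw [h1, LinearMap.det_toMatrix]
    exact Int.isUnit_sq ((h a).map LinearMap.det)
  obtain ⟨y, hy, hy0⟩ := (Submodule.ne_bot_iff _).mp
    (bot_lt_iff_ne_bot.mp (LinearMap.bot_lt_ker_of_det_eq_zero hdet))
  exact ⟨y, hy0, sub_eq_zero.mp hy⟩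

/-- A finite subgroup of an additive group `M` that is stable under the action attached to a
bijective cocycle `ℤ → M` is trivial. -/
theorem AddSubgroup.eq_bot_of_finite_of_cocycle {M : Type*} [AddGroup M] {π : ℤ → M}
    (hπ : Function.Bijective π) (h0 : π 0 = 0) (K : AddSubgroup M) [Finite K]
    (hK : ∀ m n, π n ∈ K → -π m + π (m + n) ∈ K) : K = ⊥ := by
  rw [AddSubgroup.eq_bot_iff_forall]
  intro y hy
  obtain ⟨n, rfl⟩ := hπ.2 y
  -- In the group structure carried over from ℤ, K contains all multiples of n, infinitely many
  -- unless n = 0.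
  have hmem : ∀ k : ℕ, π (k * n) ∈ K := by
    intro k
    induction k with
    | zero => simp [h0, K.zero_mem]
    | succ k ih =>
      have h := K.add_mem ih (hK (k * n) n hy)
      rw [add_neg_cancel_left] at h
      push_cast
      rwa [add_one_mul]
  obtain ⟨i, j, hij, h⟩ := Finite.exists_ne_map_eq_of_infinite fun k : ℕ => (⟨_, hmem k⟩ : K)
  have h2 := hπ.1 (Subtype.ext_iff.mp h)
  have hn : n = 0 := by
    by_contra hn
    exact hij (by exact_mod_cast mul_right_cancel₀ hn h2)
  rw [hn, h0]

/-! ### Bijective cocycles of ℤ in an abelian group -/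

/-- Data of a bijective `1`-cocycle `ℤ → M`, the generator of `ℤ` acting by `u`. -/
structure IsBijectiveCocycle {M : Type*} [AddCommGroup M] (u : (Module.End ℤ M)ˣ) (π : ℤ → M) :
    Prop where
  bijective : Function.Bijective π
  apply_add : ∀ m n, π (m + n) = π m + (↑(u ^ m) : Module.End ℤ M) (π n)

namespace IsBijectiveCocycle

variable {M : Type*} [AddCommGroup M] {u : (Module.End ℤ M)ˣ} {π : ℤ → M}
  (h : IsBijectiveCocycle u π)

include h

theorem apply_zero : π 0 = 0 := by
  have := h.apply_add 0 0
  simpa using this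

theorem apply_one_add (n : ℤ) : π (1 + n) = π 1 + (u : Module.End ℤ M) (π n) := by
  simpa using h.apply_add 1 n

theorem nontrivial : Nontrivial M :=
  ⟨π 0, π 1, fun e => zero_ne_one (h.bijective.1 e)⟩

/-- `π 1` generates `M` as a `ℤ[u, u⁻¹]`-module. -/
theorem eq_top (W : Submodule ℤ M) (h1 : π 1 ∈ W)
    (hu : ∀ y ∈ W, (u : Module.End ℤ M) y ∈ W)
    (hv : ∀ y ∈ W, (↑u⁻¹ : Module.End ℤ M) y ∈ W) : W = ⊤ := by
  rw [Submodule.eq_top_iff']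
  intro y
  obtain ⟨n, rfl⟩ := h.bijective.2 y
  induction n using Int.induction_on with
  | zero => rw [h.apply_zero]; exact W.zero_mem
  | succ n ih => rw [add_comm, h.apply_one_add]; exact W.add_mem h1 (hu _ ih)
  | pred n ih =>
    have e := h.apply_one_add (-n - 1)
    rw [add_sub_cancel, ← sub_eq_iff_eq_add'] at e
    have := hv _ (W.sub_mem ih h1)
    rw [e, ← Module.End.mul_apply, Units.inv_mul] at this
    exact this

/-- The kernel of p - q contains π 1 and is stable under u and its inverse, so `eq_top` applies. -/
theorem eq_of_apply_one {p q : Module.End ℤ M} (hp : Commute (u : Module.End ℤ M) p)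
    (hq : Commute (u : Module.End ℤ M) q) (e : p (π 1) = q (π 1)) : p = q := by
  have hc : Commute (u : Module.End ℤ M) (p - q) := hp.sub_right hq
  have hc' : Commute (↑u⁻¹ : Module.End ℤ M) (p - q) := hc.units_inv_left
  rw [← sub_eq_zero, ← LinearMap.ker_eq_top]
  refine h.eq_top _ (by simp [e]) (fun y hy => ?_) (fun y hy => ?_)
  · rw [LinearMap.mem_ker] at hy ⊢
    rw [← Module.End.mul_apply, ← hc.eq, Module.End.mul_apply, hy, map_zero]
  · rw [LinearMap.mem_ker] at hy ⊢
    rw [← Module.End.mul_apply, ← hc'.eq, Module.End.mul_apply, hy, map_zero]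

/-- Expand π (n + 1) = π (1 + n) by the cocycle rule in both orders. -/
theorem sub_one_apply (n : ℤ) :
    ((u : Module.End ℤ M) - 1) (π n) = ((↑(u ^ n) : Module.End ℤ M) - 1) (π 1) := by
  have e := h.apply_one_add n
  rw [add_comm, h.apply_add] at e
  simp only [LinearMap.sub_apply, Module.End.one_apply]
  rw [sub_eq_sub_iff_add_eq_add, add_comm _ (π 1), ← e, add_comm]

/-- Every map commuting with `u` is `(u ^ n - 1) / (u - 1)` for some `n`. -/
theorem exists_sub_one_mul {p : Module.End ℤ M} (hp : Commute (u : Module.End ℤ M) p) :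
    ∃ n : ℤ, (↑(u ^ n) : Module.End ℤ M) = 1 + ((u : Module.End ℤ M) - 1) * p := by
  obtain ⟨n, hn⟩ := h.bijective.2 (p (π 1))
  have hun : Commute (u : Module.End ℤ M) (↑(u ^ n) : Module.End ℤ M) := by
    have : Commute u (u ^ n) := (Commute.refl u).zpow_right n
    rw [commute_iff_eq, ← Units.val_mul, this.eq, Units.val_mul]
  have hu1 : Commute (u : Module.End ℤ M) ((u : Module.End ℤ M) - 1) :=
    (Commute.refl _).sub_right (Commute.one_right _)
  refine ⟨n, ?_⟩
  rw [← sub_eq_iff_eq_add']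
  refine h.eq_of_apply_one (hun.sub_right (Commute.one_right _)) (hu1.mul_right hp) ?_
  rw [Module.End.mul_apply, ← hn, h.sub_one_apply]

/-- `u` is annihilated by a monic polynomial with constant term `-1`. -/
theorem exists_monic : ∃ q r : ℤ[X], q.Monic ∧
    aeval (u : Module.End ℤ M) q = 0 ∧ q = X * r - 1 := by
  have hcomm : Commute (u : Module.End ℤ M) (1 + u ^ 2) :=
    (Commute.one_right _).add_right ((Commute.refl _).pow_right 2)
  obtain ⟨l, hl⟩ := h.exists_sub_one_mul hcomm
  have hcancel : ∀ p : Module.End ℤ M, (u : Module.End ℤ M) * p = 0 → p = 0 := fun p hp =>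
    (Units.mul_right_eq_zero u).mp hp
  have hl' : (↑(u ^ l) : Module.End ℤ M) = u ^ 3 - u ^ 2 + u := by
    rw [hl]; noncomm_ring
  -- Whatever l is, u^l = u³ - u² + u is a nontrivial relation; clearing or cancelling powers of u
  -- leaves extreme coefficients ±1.
  obtain hneg | rfl | rfl | rfl | hbig : l ≤ 0 ∨ l = 1 ∨ l = 2 ∨ l = 3 ∨ 4 ≤ l := by omega
  · obtain ⟨k, rfl⟩ : ∃ k : ℕ, l = -k := ⟨(-l).toNat, by omega⟩
    refine ⟨_, X ^ (k + 2) - X ^ (k + 1) + X ^ k, ?_, ?_, rfl⟩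
    · have : (X * (X ^ (k + 2) - X ^ (k + 1) + X ^ k) - 1 : ℤ[X]) =
        X ^ (k + 3) + (- X ^ (k + 2) + X ^ (k + 1) - 1) := by ring
      rw [this]
      refine monic_X_pow_add ((degree_le_of_natDegree_le (n := k + 2) ?_).trans_lt ?_)
      · compute_degree
      · exact_mod_cast Nat.lt_succ_self _
    · have e : (u : Module.End ℤ M) ^ k * ↑(u ^ (-k : ℤ)) = 1 := by
        rw [← Units.val_pow_eq_pow_val, ← Units.val_mul, ← zpow_natCast, ← zpow_add]
        simp
      rw [hl'] at e
      have e2 : (X * (X ^ (k + 2) - X ^ (k + 1) + X ^ k) - 1 : ℤ[X]) =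
        X ^ k * (X ^ 3 - X ^ 2 + X) - 1 := by ring
      simp [e2, e]
  · refine ⟨X * 1 - 1, 1, by simpa using monic_X_sub_C (1 : ℤ), ?_, rfl⟩
    have e := hcancel ((u : Module.End ℤ M) - 1) (hcancel _ (by
      rw [zpow_one] at hl'
      have : (u : Module.End ℤ M) * (u * (u - 1)) = (u ^ 3 - u ^ 2 + u) - u := by noncomm_ring
      rw [this, ← hl', sub_self]))
    simpa using e
  -- Here (u - 1)² = 0; the cube (X - 1)³ is used because its constant term is -1.
  · refine ⟨_, X ^ 2 - 3 * X + 3, ?_, ?_, rfl⟩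
    · have : (X * (X ^ 2 - 3 * X + 3) - 1 : ℤ[X]) = X ^ 3 + (-3 * X ^ 2 + 3 * X - 1) := by ring
      rw [this]
      refine monic_X_pow_add ((degree_le_of_natDegree_le (n := 2) ?_).trans_lt ?_)
      · compute_degree
      · exact_mod_cast Nat.lt_succ_self _
    · have e := hcancel (((u : Module.End ℤ M) - 1) * (u - 1)) (by
        have : (u : Module.End ℤ M) * ((u - 1) * (u - 1)) = (u ^ 3 - u ^ 2 + u) - u ^ 2 := by
          noncomm_ring
        rw [this, ← hl', sub_eq_zero]
        norm_cast)
      have e2 : (X * (X ^ 2 - 3 * X + 3) - 1 : ℤ[X]) = (X - 1) * ((X - 1) * (X - 1)) := by ring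
      rw [e2]
      simp [e]
  · refine ⟨X * 1 - 1, 1, by simpa using monic_X_sub_C (1 : ℤ), ?_, rfl⟩
    have e := hcancel ((u : Module.End ℤ M) - 1) (by
      have : (u : Module.End ℤ M) * (u - 1) = u ^ 3 - (u ^ 3 - u ^ 2 + u) := by noncomm_ring
      rw [this, ← hl', sub_eq_zero]
      norm_cast)
    simpa using e
  · obtain ⟨k, rfl⟩ : ∃ k : ℕ, l = (k + 4 : ℕ) := ⟨(l - 4).toNat, by omega⟩
    refine ⟨_, X ^ (k + 2) - X + 1, ?_, ?_, rfl⟩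
    · have : (X * (X ^ (k + 2) - X + 1) - 1 : ℤ[X]) = X ^ (k + 3) + (-X ^ 2 + X - 1) := by ring
      rw [this]
      refine monic_X_pow_add ((degree_le_of_natDegree_le (n := 2) ?_).trans_lt ?_)
      · compute_degree
      · exact_mod_cast (by omega : 2 < k + 3)
    · apply hcancel
      rw [zpow_natCast, Units.val_pow_eq_pow_val] at hl'
      have e2 : (X * (X * (X ^ (k + 2) - X + 1) - 1) : ℤ[X]) =
        X ^ (k + 4) - (X ^ 3 - X ^ 2 + X) := by ring
      have e3 := congrArg (aeval (u : Module.End ℤ M)) e2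
      rw [map_mul, aeval_X] at e3
      rw [e3]
      simp [hl']

/-- ℤ[u] is finite over ℤ since u is integral, and it contains u⁻¹ = r(u); hence its orbit of π 1 is
all of M. -/
theorem moduleFinite : Module.Finite ℤ M := by
  obtain ⟨q, r, hq, hq0, hr⟩ := h.exists_monic
  have hint : IsIntegral ℤ (u : Module.End ℤ M) := ⟨q, hq, hq0⟩
  let S := Algebra.adjoin ℤ {(u : Module.End ℤ M)}
  have hfg : (S.toSubmodule.map (LinearMap.applyₗ (R := ℤ) (π 1))).FG :=
    hint.fg_adjoin_singleton.map _
  have hinv : (↑u⁻¹ : Module.End ℤ M) = aeval (u : Module.End ℤ M) r := by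
    rw [hr, map_sub, map_mul, Polynomial.aeval_X, map_one, sub_eq_zero] at hq0
    exact Units.inv_eq_of_mul_eq_one_right hq0
  refine ⟨(h.eq_top _ ?_ ?_ ?_) ▸ hfg⟩
  · exact ⟨1, S.one_mem, rfl⟩
  · rintro _ ⟨p, hp, rfl⟩
    exact ⟨u * p, S.mul_mem (Algebra.self_mem_adjoin_singleton ℤ _) hp, rfl⟩
  · rintro _ ⟨p, hp, rfl⟩
    refine ⟨(↑u⁻¹ : Module.End ℤ M) * p, S.mul_mem ?_ hp, rfl⟩
    rw [hinv]
    exact Polynomial.aeval_mem_adjoin_singleton ℤ _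

/-- Finitely generated torsion is finite and stable under u, so the bijective cocycle kills it. -/
theorem torsion_eq_bot : Submodule.torsion ℤ M = ⊥ := by
  have := h.moduleFinite
  have : Finite (Submodule.torsion ℤ M) := Module.finite_of_fg_torsion _ Submodule.torsion_isTorsion
  have : Finite (Submodule.torsion ℤ M).toAddSubgroup := this
  rw [← Submodule.toAddSubgroup_inj]
  refine AddSubgroup.eq_bot_of_finite_of_cocycle h.bijective h.apply_zero _ fun m n hn => ?_
  rw [h.apply_add, neg_add_cancel_left]
  obtain ⟨a, ha⟩ := hn
  refine ⟨a, ?_⟩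
  rw [Submonoid.smul_def] at ha ⊢
  rw [← map_smul, ha, map_zero]

/-- The operator `(u ^ m - 1) / (u - 1)` sends `π 1` to `π m` and multiplies fixed vectors by `m`. -/
theorem exists_commute_apply {y : M} (hy : (u : Module.End ℤ M) y = y) (m : ℤ) :
    ∃ Q : Module.End ℤ M, Commute (u : Module.End ℤ M) Q ∧ Q (π 1) = π m ∧ Q y = m • y := by
  have hv : (↑u⁻¹ : Module.End ℤ M) y = y := by
    conv_lhs => rw [← hy]
    rw [← Module.End.mul_apply, Units.inv_mul, Module.End.one_apply]
  have huv : Commute (u : Module.End ℤ M) (↑u⁻¹ : Module.End ℤ M) := by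
    rw [commute_iff_eq, Units.mul_inv, Units.inv_mul]
  induction m using Int.induction_on with
  | zero => exact ⟨0, Commute.zero_right _, by simp [h.apply_zero], by simp⟩
  | succ n ih =>
    obtain ⟨Q, hc, h1, h2⟩ := ih
    refine ⟨1 + u * Q, (Commute.one_right _).add_right ((Commute.refl _).mul_right hc), ?_, ?_⟩
    · rw [add_comm (n : ℤ), h.apply_one_add, ← h1]; rfl
    · rw [LinearMap.add_apply, Module.End.mul_apply, h2, map_smul, hy, add_smul, one_smul,
        add_comm, Module.End.one_apply]
  | pred n ih =>
    obtain ⟨Q, hc, h1, h2⟩ := ih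
    refine ⟨↑u⁻¹ * (Q - 1), huv.mul_right (hc.sub_right (Commute.one_right _)), ?_, ?_⟩
    · have e := h.apply_one_add (-n - 1)
      rw [add_sub_cancel, ← sub_eq_iff_eq_add'] at e
      rw [Module.End.mul_apply, LinearMap.sub_apply, h1, Module.End.one_apply, e,
        ← Module.End.mul_apply, Units.inv_mul, Module.End.one_apply]
    · rw [Module.End.mul_apply, LinearMap.sub_apply, h2, Module.End.one_apply, map_sub, map_smul,
        hv, sub_smul, one_smul]

/-- A bijective cocycle of `ℤ` with values in an abelian group is an isomorphism for the trivial
action. -/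
theorem eq_one : (u : Module.End ℤ M) = 1 := by
  have := h.moduleFinite
  have := h.nontrivial
  have : Module.IsTorsionFree ℤ M := Submodule.isTorsionFree_iff_torsion_eq_bot.mpr h.torsion_eq_bot
  have : Module.Free ℤ M := inferInstance
  obtain ⟨y, hy0, hy⟩ := Module.End.exists_fixed_of_forall_isUnit (u : Module.End ℤ M) fun a => by
    obtain ⟨n, hn⟩ := h.exists_sub_one_mul (p := a • 1) ((Commute.one_right _).smul_right a)
    rw [mul_smul_comm, mul_one] at hn
    exact hn ▸ Units.isUnit _
  -- Q and 2 agree on π 1, hence everywhere; on the fixed vector y this reads m y = 2 y. Then π 2 =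
  -- 2 π 1, while the cocycle rule gives π 2 = π 1 + u(π 1).
  obtain ⟨m, hm⟩ := h.bijective.2 ((2 : ℤ) • π 1)
  obtain ⟨Q, hc, h1, h2⟩ := h.exists_commute_apply hy m
  have hQ : Q = (2 : ℤ) • 1 :=
    h.eq_of_apply_one hc ((Commute.one_right _).smul_right _) (by rw [h1, hm]; rfl)
  have hm2 : m = 2 := by
    rw [hQ] at h2
    exact (smul_left_injective ℤ hy0 h2).symm
  refine h.eq_of_apply_one (Commute.refl _) (Commute.one_right _) ?_
  have e := h.apply_one_add 1
  rw [one_add_one_eq_two, ← hm2, hm, two_smul] at e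
  exact (add_left_cancel e).symm

end IsBijectiveCocycle

namespace SkewLeftBrace

/-! ### Braces with infinite cyclic multiplicative group -/

section Cyclic

variable {A : Type u} [SkewLeftBrace A]

/-- The bijection `ℤ → A` given by an isomorphism of `(A, ∘)` with `ℤ`. -/
def param (e : A ≃* Multiplicative ℤ) (n : ℤ) : A := e.symm (Multiplicative.ofAdd n)

theorem param_bijective (e : A ≃* Multiplicative ℤ) : Function.Bijective (param e) :=
  e.symm.bijective.comp Multiplicative.ofAdd.bijective

theorem param_zero (e : A ≃* Multiplicative ℤ) : param e 0 = 0 := by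
  rw [zero_eq_one, param, ofAdd_zero, map_one]

theorem param_add (e : A ≃* Multiplicative ℤ) (m n : ℤ) :
    param e (m + n) = param e m * param e n := by
  rw [param, ofAdd_add, map_mul]; rfl

theorem param_eq_zpow (e : A ≃* Multiplicative ℤ) (n : ℤ) : param e n = param e 1 ^ n := by
  rw [param, param, ← map_zpow, ← ofAdd_zsmul, smul_eq_mul, mul_one]

/-- If `(A, ∘)` is infinite cyclic, finite additive subgroups stable under all `λ_a` are zero. -/
theorem eq_bot_of_finite_of_lam_mem (e : A ≃* Multiplicative ℤ) (K : AddSubgroup A) [Finite K]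
    (hK : ∀ a, ∀ x ∈ K, lam a x ∈ K) : K = ⊥ :=
  K.eq_bot_of_finite_of_cocycle (param_bijective e) (param_zero e) fun m n hn => by
    rw [param_add]
    exact hK _ _ hn

/-- A skew left brace of abelian type with infinite cyclic multiplicative group is trivial. -/
theorem IsOfAbelianType.lam_eq (h : IsOfAbelianType A) (e : A ≃* Multiplicative ℤ) (a b : A) :
    lam a b = b := by
  let : AddCommGroup A := { (inferInstance : AddGroup A) with add_comm := h }
  let Λ : A →* Module.End ℤ A :=
    { toFun := fun a => (AddMonoidHom.mk' (lam a) (lam_add a)).toIntLinearMap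
      map_one' := by ext x; exact lam_one x
      map_mul' := fun a b => by ext x; exact lam_circ a b x }
  have hc : IsBijectiveCocycle (Λ.toHomUnits (param e 1)) (param e) :=
    ⟨param_bijective e, fun m n => by
      rw [← map_zpow, ← param_eq_zpow, param_add, circ_eq]; rfl⟩
  obtain ⟨n, rfl⟩ := (param_bijective e).2 a
  have hΛ : Λ (param e n) = 1 := by
    have h1 : Λ.toHomUnits (param e 1) = 1 := Units.ext hc.eq_one
    rw [param_eq_zpow, ← MonoidHom.coe_toHomUnits, map_zpow, h1, one_zpow, Units.val_one]
  exact LinearMap.congr_fun hΛ b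

theorem hasFiniteMultipermutationLevel_of_lam_eq (h : IsOfAbelianType A)
    (hlam : ∀ a b : A, lam a b = b) : HasFiniteMultipermutationLevel A := by
  -- Index 1 is S_2 = A / Soc(A), a single point because every element lies in the socle.
  refine ⟨1, ⟨fun x y => ?_⟩⟩
  change (socle A).Factor at x y
  obtain ⟨a, rfl⟩ := (socle A).proj_surjective x
  obtain ⟨b, rfl⟩ := (socle A).proj_surjective y
  exact ((socle A).proj_eq_iff a b).mpr (inSocle_of (hlam _) (h _))

end Cyclic

/-! ### From finite multipermutation level to abelian type -/

section Multipermutation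

variable {A : Type u} [SkewLeftBrace A]

/-- If the socle of `S` is zero then so is the socle of `S / Soc(S)`. -/
theorem Bundled.modSocle_socle_eq_zero (S : Bundled.{u})
    (h : ∀ x : S.carrier, InSocle x → x = 0) :
    ∀ x : S.modSocle.carrier, InSocle x → x = 0 := by
  intro x hx
  change (socle S.carrier).Factor at x
  obtain ⟨a, rfl⟩ := (socle S.carrier).proj_surjective x
  -- With zero socle the projection is injective, so socle identities in the quotient lift to S.
  have hinj : Function.Injective (socle S.carrier).proj := by
    intro a b hab
    rw [Ideal.proj_eq_iff] at hab
    exact neg_add_eq_zero.mp (h _ hab)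
  have ha : a = 0 := h a fun b =>
    ⟨hinj (hx ((socle S.carrier).proj b)).1, hinj (hx ((socle S.carrier).proj b)).2⟩
  rw [ha]; rfl

theorem Bundled.modSocle_nontrivial (S : Bundled.{u})
    (h : ∀ x : S.carrier, InSocle x → x = 0) [Nontrivial S.carrier] :
    Nontrivial S.modSocle.carrier := by
  obtain ⟨a, ha⟩ := exists_ne (0 : S.carrier)
  refine ⟨(socle S.carrier).proj 0, (socle S.carrier).proj a, fun e => ha ?_⟩
  have e2 := ((socle S.carrier).proj_eq_iff 0 a).mp e
  rw [neg_zero, zero_add] at e2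
  exact h a e2

theorem Bundled.iterate_modSocle_nontrivial (n : ℕ) (S : Bundled.{u})
    (h : ∀ x : S.carrier, InSocle x → x = 0) (hS : Nontrivial S.carrier) :
    Nontrivial (Bundled.modSocle^[n] S).carrier := by
  induction n generalizing S with
  | zero => exact hS
  | succ n ih =>
    exact ih _ (S.modSocle_socle_eq_zero h) (S.modSocle_nontrivial h)

/-- A nonzero skew left brace of finite multipermutation level has nonzero socle. -/
theorem HasFiniteMultipermutationLevel.exists_inSocle_ne_zero [Nontrivial A]
    (h : HasFiniteMultipermutationLevel A) : ∃ x : A, InSocle x ∧ x ≠ 0 := by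
  by_contra! hs
  obtain ⟨n, hn⟩ := h
  have := Bundled.iterate_modSocle_nontrivial n ⟨A⟩ hs inferInstance
  exact not_subsingleton (Bundled.modSocle^[n] ⟨A⟩).carrier hn

/-- If `(A, ∘)` is infinite cyclic, every nonzero ideal has finite additive index. -/
theorem Ideal.finite_quotient (e : A ≃* Multiplicative ℤ) (I : Ideal A) {x : A}
    (hx : x ∈ I.toAddSubgroup) (hx0 : x ≠ 0) : Finite (A ⧸ I.toAddSubgroup) := by
  obtain ⟨k, rfl⟩ := (param_bijective e).2 x
  have hk : k ≠ 0 := by rintro rfl; exact hx0 (param_zero e)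
  -- Additive and multiplicative cosets agree, so residues modulo k represent all of them.
  have hsurj : ∀ y : A ⧸ I.toAddSubgroup, ∃ i : Set.Ico 0 |k|, I.proj (param e i) = y := by
    intro y
    obtain ⟨a, rfl⟩ := I.proj_surjective y
    obtain ⟨n, rfl⟩ := (param_bijective e).2 a
    refine ⟨⟨n % k, Int.emod_nonneg n hk, Int.emod_lt_abs n hk⟩, ?_⟩
    rw [Ideal.proj_eq_iff_circ]
    have hpow : (param e (n % k))⁻¹ * param e n = param e k ^ (n / k) := by
      rw [inv_mul_eq_iff_eq_mul, param_eq_zpow e k, ← zpow_mul, ← param_eq_zpow, ← param_add,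
        Int.emod_add_mul_ediv]
    rw [hpow]
    exact I.toSubgroup.zpow_mem hx _
  choose f hf using hsurj
  exact Finite.of_injective f fun y z hyz => by rw [← hf y, ← hf z, hyz]

/-- A skew left brace of finite multipermutation level with infinite cyclic multiplicative group is
of abelian type. -/
theorem HasFiniteMultipermutationLevel.isOfAbelianType (h : HasFiniteMultipermutationLevel A)
    (e : A ≃* Multiplicative ℤ) : IsOfAbelianType A := by
  have : Nontrivial A := e.toEquiv.nontrivial
  obtain ⟨x, hx, hx0⟩ := h.exists_inSocle_ne_zero
  have hfin := (socle A).finite_quotient e (show x ∈ (socle A).toAddSubgroup from hx) hx0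
  let H : Subgroup (Multiplicative A) := AddSubgroup.toSubgroup (socle A).toAddSubgroup
  have : Finite (Multiplicative A ⧸ H) := by
    refine Finite.of_surjective
      (fun q : A ⧸ (socle A).toAddSubgroup =>
        (QuotientGroup.mk (Multiplicative.ofAdd q.out) : Multiplicative A ⧸ H)) ?_
    intro y
    obtain ⟨a, rfl⟩ := QuotientGroup.mk_surjective y
    refine ⟨QuotientAddGroup.mk a.toAdd, ?_⟩
    rw [QuotientGroup.eq]
    have hmem : -(QuotientAddGroup.mk a.toAdd : A ⧸ (socle A).toAddSubgroup).out + a.toAdd ∈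
        (socle A).toAddSubgroup := QuotientAddGroup.eq.mp (QuotientAddGroup.out_eq' _)
    exact hmem
  have : Finite (commutator (Multiplicative A)) :=
    finite_commutator_of_le_center H fun c hc => Subgroup.mem_center_iff.mpr fun g =>
      ((hc : InSocle c.toAdd) g.toAdd).2.symm
  let K : AddSubgroup A := Subgroup.toAddSubgroup' (commutator (Multiplicative A))
  have : Finite K := this
  -- Each `lam a` is an additive endomorphism, so it preserves the commutator subgroup.
  have hK : K = ⊥ := eq_bot_of_finite_of_lam_mem e K fun a y hy => by
    let φ : Multiplicative A →* Multiplicative A :=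
      AddMonoidHom.toMultiplicative (AddMonoidHom.mk' (lam a) (lam_add a))
    have hmap : (commutator (Multiplicative A)).map φ ≤ commutator (Multiplicative A) := by
      rw [commutator_def, Subgroup.map_commutator]
      exact Subgroup.commutator_mono le_top le_top
    exact hmap ⟨_, hy, rfl⟩
  intro a b
  have hab : ⁅Multiplicative.ofAdd a, Multiplicative.ofAdd b⁆ ∈ commutator (Multiplicative A) :=
    Subgroup.commutator_mem_commutator (Subgroup.mem_top _) (Subgroup.mem_top _)
  have hzero : (⁅Multiplicative.ofAdd a, Multiplicative.ofAdd b⁆ : Multiplicative A).toAdd ∈ K := hab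
  rw [hK, AddSubgroup.mem_bot, toAdd_eq_zero, commutatorElement_eq_one_iff_mul_comm,
    ← ofAdd_add, ← ofAdd_add] at hzero
  exact Multiplicative.ofAdd.injective hzero

end Multipermutation

end SkewLeftBrace

theorem mainTheorem6 {A : Type u} [SkewLeftBrace A] (hA : Nonempty (A ≃* Multiplicative ℤ)) :
    SkewLeftBrace.HasFiniteMultipermutationLevel A ↔ SkewLeftBrace.IsOfAbelianType A := by
  obtain ⟨e⟩ := hA
  exact ⟨fun h => h.isOfAbelianType e, fun h =>
    SkewLeftBrace.hasFiniteMultipermutationLevel_of_lam_eq h (h.lam_eq e)⟩
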